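/- Let $\mathcal{S}$ be a set of integers contained in an interval $[N,N+M]$ with $M>0$, and write $S:=\#\mathcal{S}$. Let $\mathcal{Q}$ be a finite set of pairwise coprime positive integers, and suppose that for each $q\in\mathcal{Q}$ an integer $\nu(q)$ with $1\le\nu(q)\le q$ is given such that the elements of $\mathcal{S}$ belong to at most $\nu(q)$ congruence classes modulo $q$. Let $\Lambda$ denote the von Mangoldt function. Then either $S\le 1243$, or the inequality $$ S<\frac{\sum_{q\in\mathcal{Q}}\Lambda(q)-\log M+1.38}{\sum_{q\in\mathcal{Q}}\frac{\Lambda(q)}{\nu(q)}-\log M+1.38} $$ holds provided that the denominator is positive. -/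

import Mathlib

/-! Gallagher's larger sieve, sharpened by an exact extremal discriminant. The sum of `log |a - b|`
over ordered pairs of distinct elements of `S` is bounded from both sides.

Below: since the `Λ(d)` with `d ∣ n` add up to `log n`, the sum is at least the total of `Λ(q)`
times the number of pairs congruent mod `q`, and Cauchy–Schwarz bounds that number by `S²/ν(q) - S`
(`sum_vonMangoldt_mul_le_sum_log`).

Above: after rescaling to `[-1, 1]`, the maximal discriminant of `n` points is attained at the zeros
of `(1 - x²) P'_{n-1}` (Stieltjes; `prod_abs_sub_le_maxDiscr`). Resultants give its value, with
logarithm about `-n² log 2`. The rescaling adds `n(n-1) log (M/2)`, so the constant tends to `2 log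
2 = 1.386...`; `1.38` is reached from `n = 1244` on (`log_maxDiscr_lt`).

Comparing the two bounds and dividing by `S` leaves a linear inequality in `S`. -/

/-! ### Monic Legendre and Lobatto polynomials, and their differential equation. -/

open Polynomial in
/-- The monic Legendre polynomials. -/
noncomputable def monicLegendre : ℕ → ℝ[X]
  | 0 => 1
  | 1 => X
  | k + 2 => X * monicLegendre (k + 1) -
      C (((k : ℝ) + 1) ^ 2 / (4 * ((k : ℝ) + 1) ^ 2 - 1)) * monicLegendre k

open Polynomial in
theorem monic_X_mul_sub_C_mul {f g : ℝ[X]} {n : ℕ} (hf : f.Monic) (hfn : f.natDegree = n)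
    (hg : g.natDegree ≤ n) (b : ℝ) :
    (X * f - C b * g).Monic ∧ (X * f - C b * g).natDegree = n + 1 := by
  have h1 : (X * f).Monic := monic_X.mul hf
  have h2 : (X * f).natDegree = n + 1 := by
    rw [monic_X.natDegree_mul hf, natDegree_X, hfn, add_comm]
  have h3 : (C b * g).degree < (X * f).degree := by
    rw [degree_eq_natDegree h1.ne_zero, h2]
    refine lt_of_le_of_lt degree_le_natDegree ?_
    exact_mod_cast ((natDegree_C_mul_le b g).trans hg).trans_lt (Nat.lt_succ_self n)
  refine ⟨h1.sub_of_left h3, ?_⟩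
  rw [natDegree_sub_eq_left_of_natDegree_lt, h2]
  rw [h2]
  exact ((natDegree_C_mul_le b g).trans hg).trans_lt (Nat.lt_succ_self n)

open Polynomial in
theorem monicLegendre_monic_natDegree (k : ℕ) :
    (monicLegendre k).Monic ∧ (monicLegendre k).natDegree = k := by
  induction k using Nat.strong_induction_on with
  | _ k ih =>
    match k with
    | 0 => simp [monicLegendre]
    | 1 => simp [monicLegendre, monic_X]
    | k + 2 =>
      obtain ⟨h1, h2⟩ := ih (k + 1) (by omega)
      obtain ⟨h3, h4⟩ := ih k (by omega)
      rw [monicLegendre]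
      exact monic_X_mul_sub_C_mul h1 h2 (by omega) _

open Polynomial in
/-- The monic node polynomial of degree `k + 2`, proportional to `(1 - X ^ 2)` times the derivative
of the Legendre polynomial of degree `k + 1`. -/
noncomputable def lobattoPoly (k : ℕ) : ℝ[X] :=
  X * monicLegendre (k + 1) - C (((k : ℝ) + 1) / (2 * k + 1)) * monicLegendre k

open Polynomial in
theorem lobattoPoly_monic_natDegree (k : ℕ) :
    (lobattoPoly k).Monic ∧ (lobattoPoly k).natDegree = k + 2 := by
  obtain ⟨h1, h2⟩ := monicLegendre_monic_natDegree (k + 1)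
  obtain ⟨-, h4⟩ := monicLegendre_monic_natDegree k
  exact monic_X_mul_sub_C_mul h1 h2 (by omega) _

-- Monic forms of `x P_n' - P_{n-1}' = n P_n` and `(x² - 1) P_n' = n (x P_n - P_{n-1})`. They are
-- proved together because the inductive step for each uses both.
open Polynomial in
theorem monicLegendre_derivative_relations (k : ℕ) (x : ℝ) :
    x * (derivative (monicLegendre (k + 1))).eval x -
        ((k : ℝ) + 1) / (2 * k + 1) * (derivative (monicLegendre k)).eval x
      = (k + 1) * (monicLegendre (k + 1)).eval x ∧
    (x ^ 2 - 1) * (derivative (monicLegendre (k + 1))).eval x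
      = (k + 1) * (x * (monicLegendre (k + 1)).eval x -
        ((k : ℝ) + 1) / (2 * k + 1) * (monicLegendre k).eval x) := by
  induction k with
  | zero => simp [monicLegendre]; ring
  | succ k ih =>
    obtain ⟨h1, h2⟩ := ih
    have e1 : (monicLegendre (k + 2)).eval x = x * (monicLegendre (k + 1)).eval x -
      ((k : ℝ) + 1) ^ 2 / (4 * ((k : ℝ) + 1) ^ 2 - 1) * (monicLegendre k).eval x := by
      simp [monicLegendre]
    have e2 : (derivative (monicLegendre (k + 2))).eval x =
      (monicLegendre (k + 1)).eval x + x * (derivative (monicLegendre (k + 1))).eval x -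
      ((k : ℝ) + 1) ^ 2 / (4 * ((k : ℝ) + 1) ^ 2 - 1) *
        (derivative (monicLegendre k)).eval x := by
      simp [monicLegendre]
    have hk : (0 : ℝ) ≤ k := k.cast_nonneg
    have d1 : (2 * (k : ℝ) + 1) ≠ 0 := by positivity
    have d3 : (2 * (k : ℝ) + 3) ≠ 0 := by positivity
    have d2 : 4 * ((k : ℝ) + 1) ^ 2 - 1 = (2 * k + 1) * (2 * k + 3) := by ring
    rw [show k + 1 + 1 = k + 2 from rfl, e1, e2, d2]
    push_cast
    rw [show 2 * ((k : ℝ) + 1) + 1 = 2 * k + 3 by ring]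
    generalize (monicLegendre (k + 1)).eval x = P at *
    generalize (monicLegendre k).eval x = R at *
    generalize (derivative (monicLegendre (k + 1))).eval x = P' at *
    have h3 : P + x * P' - ((k : ℝ) + 1) ^ 2 / ((2 * k + 1) * (2 * k + 3)) *
        (derivative (monicLegendre k)).eval x
        = ((k : ℝ) + 2) / (2 * k + 3) * (x * P' + (k + 2) * P) := by
      have : ((k : ℝ) + 1) ^ 2 / ((2 * k + 1) * (2 * k + 3)) *
        (derivative (monicLegendre k)).eval x = (k + 1) / (2 * k + 3) *
          (((k : ℝ) + 1) / (2 * k + 1) * (derivative (monicLegendre k)).eval x) := by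
        field_simp
      rw [this, ← sub_eq_iff_eq_add'.mpr (sub_eq_iff_eq_add.mp h1)]
      field_simp
      ring
    rw [h3]
    have h4 : ((k : ℝ) + 1) ^ 2 / ((2 * k + 1) * (2 * k + 3)) * R =
        1 / (2 * k + 3) * ((k + 1) * (((k : ℝ) + 1) / (2 * k + 1) * R)) := by field_simp
    rw [h4]
    generalize ((k : ℝ) + 1) / (2 * k + 1) * R = R' at *
    constructor
    · field_simp
      linear_combination ((k : ℝ) + 2) * h2
    · field_simp
      linear_combination x * ((k : ℝ) + 2) * h2

open Polynomial in
theorem derivative_lobattoPoly (k : ℕ) :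
    derivative (lobattoPoly k) = C ((k : ℝ) + 2) * monicLegendre (k + 1) := by
  refine Polynomial.funext fun x => ?_
  have := (monicLegendre_derivative_relations k x).1
  simp only [lobattoPoly, derivative_sub, derivative_mul, derivative_X, derivative_C, eval_sub,
    eval_add, eval_mul, eval_X, eval_C, eval_one, eval_zero]
  linear_combination this

open Polynomial in
theorem lobattoPoly_ode (k : ℕ) :
    (1 - X ^ 2) * derivative (derivative (lobattoPoly k)) +
      C (((k : ℝ) + 2) * (k + 1)) * lobattoPoly k = 0 := by
  rw [derivative_lobattoPoly]
  refine Polynomial.funext fun x => ?_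
  have := (monicLegendre_derivative_relations k x).2
  simp only [lobattoPoly, derivative_mul, derivative_C, eval_sub, eval_pow,
    eval_add, eval_mul, eval_X, eval_C, eval_one, eval_zero]
  linear_combination (-(k : ℝ) - 2) * this

open Polynomial in
/-- The equation `(1 - X ^ 2) f'' + n (n - 1) f = 0` has no nonzero solution of degree below `n`. -/
theorem eq_zero_of_ode_of_natDegree_lt {f : ℝ[X]} {k : ℕ} (hd : f.natDegree < k + 2)
    (h : (1 - X ^ 2) * derivative (derivative f) + C (((k : ℝ) + 2) * (k + 1)) * f = 0) :
    f = 0 := by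
  by_contra hf
  -- Compare coefficients at the degree `m` of `f`: the operator multiplies the leading one by
  -- `n(n-1) - m(m-1)` with `n = k + 2`, which is nonzero for `m < n`.
  have hc := congrArg (fun p : ℝ[X] => p.coeff f.natDegree) h
  have hl : f.coeff f.natDegree ≠ 0 := leadingCoeff_ne_zero.mpr hf
  have h0 : (derivative (derivative f)).coeff f.natDegree = 0 := by
    rw [coeff_derivative, coeff_derivative, coeff_eq_zero_of_natDegree_lt (by omega)]; simp
  rw [sub_mul, one_mul] at hc
  simp only [coeff_add, coeff_sub, coeff_C_mul, coeff_zero, h0] at hc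
  rcases Nat.lt_or_ge f.natDegree 2 with h2 | h2
  · rw [coeff_X_pow_mul', if_neg (by omega)] at hc
    have : ((k : ℝ) + 2) * (k + 1) ≠ 0 := by positivity
    simp at hc
    rcases hc with hc | hc
    · exact this (by rcases hc with hc | hc <;> simp [hc])
    · exact hf hc
  · obtain ⟨d, hdd⟩ : ∃ d, f.natDegree = d + 2 := ⟨_, (Nat.sub_add_cancel h2).symm⟩
    rw [hdd] at hc hl hd
    rw [coeff_X_pow_mul, coeff_derivative, coeff_derivative] at hc
    push_cast at hc
    have hdk : (d : ℝ) + 1 ≤ k := by exact_mod_cast (by omega : d + 1 ≤ k)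
    have hd0 : (0 : ℝ) ≤ d := d.cast_nonneg
    have : (((k : ℝ) + 2) * (k + 1) - (d + 2) * (d + 1)) * f.coeff (d + 2) = 0 := by
      rw [show d + 1 + 1 = d + 2 from rfl] at hc
      linear_combination hc
    rcases mul_eq_zero.mp this with h5 | h5
    · nlinarith
    · exact hl h5

/-! ### Resultants and the discriminant at the Lobatto nodes. -/

-- One Euclidean step: modulo `f` the first argument is `-b g`, and lowering its formal degree costs
-- only powers of the leading coefficient `1` of `f`. Iterated along the three-term recurrence, it
-- evaluates the resultant of consecutive Legendre polynomials.
open Polynomial in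
theorem abs_resultant_X_mul_sub_C_mul {f g : ℝ[X]} {n : ℕ} (hf : f.Monic)
    (hfn : f.natDegree = n + 1) (hg : g.natDegree = n) (b : ℝ) :
    |resultant (X * f - C b * g) f (n + 2) (n + 1)| =
      |b| ^ (n + 1) * |resultant f g (n + 1) n| := by
  have h1 : X * f - C b * g = C (-b) * g + f * X := by rw [C_neg]; ring
  rw [h1, resultant_add_mul_left _ _ _ _ _ (by rw [natDegree_X]; omega) hfn.le,
    resultant_C_mul_left, resultant_add_left_deg _ _ _ _ _ hg.le, resultant_comm g]
  have : f.coeff (n + 1) = 1 := by rw [← hfn]; exact hf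
  simp [this, abs_mul, abs_pow]

open Polynomial in
theorem abs_resultant_monicLegendre (k : ℕ) :
    |resultant (monicLegendre (k + 1)) (monicLegendre k) (k + 1) k| =
      ∏ j ∈ Finset.range k, (((j : ℝ) + 1) ^ 2 / (4 * ((j : ℝ) + 1) ^ 2 - 1)) ^ (j + 1) := by
  induction k with
  | zero => simp [monicLegendre]
  | succ k ih =>
    obtain ⟨h1, h2⟩ := monicLegendre_monic_natDegree (k + 1)
    obtain ⟨-, h4⟩ := monicLegendre_monic_natDegree k
    rw [Finset.prod_range_succ, ← ih]
    conv_lhs => rw [monicLegendre]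
    rw [abs_resultant_X_mul_sub_C_mul h1 h2 h4, abs_of_nonneg, mul_comm]
    have : (0 : ℝ) ≤ k := k.cast_nonneg
    apply div_nonneg (by positivity)
    nlinarith

/-- The maximum of `∏ |x i - x j|` over ordered pairs of distinct indices, for `k + 2` points
in `[-1, 1]`. -/
noncomputable def maxDiscr (k : ℕ) : ℝ :=
  ((k : ℝ) + 2) ^ (k + 2) * ((((k : ℝ) + 1) / (2 * k + 1)) ^ (k + 1) *
    ∏ j ∈ Finset.range k, (((j : ℝ) + 1) ^ 2 / (4 * ((j : ℝ) + 1) ^ 2 - 1)) ^ (j + 1))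

-- The left side is the ordered discriminant of the nodes. The derivative is `(k + 2)` times a
-- Legendre polynomial, so the product over the nodes is `(k + 2) ^ (k + 2)` times a resultant.
open Polynomial in
theorem prod_abs_derivative_lobattoPoly {k : ℕ} {x : Fin (k + 2) → ℝ}
    (hx : ∏ i, (X - C (x i)) = lobattoPoly k) :
    ∏ i, |(derivative (lobattoPoly k)).eval (x i)| = maxDiscr k := by
  obtain ⟨h1, h2⟩ := monicLegendre_monic_natDegree (k + 1)
  obtain ⟨-, h4⟩ := monicLegendre_monic_natDegree k
  have key : ∏ i, (monicLegendre (k + 1)).eval (x i) =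
      resultant (lobattoPoly k) (monicLegendre (k + 1)) (k + 2) (k + 1) := by
    have hp := resultant_prod_left Finset.univ (fun i => X - C (x i)) (monicLegendre (k + 1))
      (k + 1) (by simp) h2.le
    rw [hx, (lobattoPoly_monic_natDegree k).2] at hp
    rw [hp]
    refine Finset.prod_congr rfl fun i _ => ?_
    have := resultant_X_sub_C_pow_left (x i) (monicLegendre (k + 1)) 1 (k + 1) h2.le
    rw [pow_one, pow_one] at this
    rw [natDegree_X_sub_C, this]
  have hk : (0 : ℝ) ≤ k := k.cast_nonneg
  rw [derivative_lobattoPoly]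
  simp only [eval_mul, eval_C, abs_mul, Finset.prod_mul_distrib, Finset.prod_const,
    Finset.card_univ, Fintype.card_fin]
  rw [← Finset.abs_prod, key, lobattoPoly, abs_resultant_X_mul_sub_C_mul h1 h2 h4,
    abs_resultant_monicLegendre, maxDiscr, abs_of_nonneg (by positivity),
    abs_of_nonneg (a := _ / _) (by positivity)]

/-! ### The extremal problem on `[-1, 1]`. -/

/-- Isolates the dependence on one coordinate: each pair occurs in both orders, so the factors
containing `x i` form the square of a polynomial in `x i`, free of absolute values. -/
theorem prod_prod_erase_abs_sub {ι : Type*} [Fintype ι] [DecidableEq ι] (x : ι → ℝ) (i : ι) :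
    ∏ a, ∏ b ∈ Finset.univ.erase a, |x a - x b| =
      (∏ b ∈ Finset.univ.erase i, (x i - x b)) ^ 2 *
        ∏ a ∈ Finset.univ.erase i, ∏ b ∈ (Finset.univ.erase a).erase i, |x a - x b| := by
  rw [← Finset.mul_prod_erase Finset.univ _ (Finset.mem_univ i), ← sq_abs, Finset.abs_prod, sq,
    mul_assoc]
  congr 1
  rw [← Finset.prod_mul_distrib]
  refine Finset.prod_congr rfl fun a ha => ?_
  rw [← Finset.mul_prod_erase _ _ (Finset.mem_erase.mpr ⟨(Finset.ne_of_mem_erase ha).symm,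
    Finset.mem_univ i⟩), abs_sub_comm]

open Polynomial in
theorem natDegree_ode_lt {r : ℝ[X]} {k : ℕ} (hr : r.natDegree < k + 2) (c : ℝ) :
    ((1 - X ^ 2) * derivative (derivative r) + C c * r).natDegree < k + 2 := by
  have h1 : (C c * r).natDegree < k + 2 := (natDegree_C_mul_le c r).trans_lt hr
  refine (natDegree_add_le _ _).trans_lt (max_lt ?_ h1)
  rcases Nat.lt_or_ge r.natDegree 2 with h2 | h2
  · have : derivative (derivative r) = 0 := iterate_derivative_eq_zero h2
    simp [this]
  · have h3 := natDegree_derivative_le r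
    have h4 := natDegree_derivative_le (derivative r)
    have h5 : (1 - X ^ 2 : ℝ[X]).natDegree ≤ 2 := by compute_degree
    have h6 := natDegree_mul_le (p := (1 - X ^ 2 : ℝ[X])) (q := derivative (derivative r))
    omega

-- Stieltjes' argument. Apply the differential operator to `W - lobattoPoly k`, where `W` is the
-- node polynomial: the result has degree below `k + 2` but vanishes at all `k + 2` nodes, so it is
-- zero. The difference is then a solution of too low a degree, hence zero.
open Polynomial in
theorem eq_lobattoPoly_of_eval_eq_zero {k : ℕ} {x : Fin (k + 2) → ℝ} (hx : Function.Injective x)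
    (h : ∀ i, (1 - x i ^ 2) *
      (derivative (derivative (∏ i, (X - C (x i))))).eval (x i) = 0) :
    ∏ i, (X - C (x i)) = lobattoPoly k := by
  set W : ℝ[X] := ∏ i, (X - C (x i)) with hW
  obtain ⟨hm, hd⟩ := lobattoPoly_monic_natDegree k
  have hWm : W.Monic := monic_prod_of_monic _ _ fun i _ => monic_X_sub_C _
  have hWd : W.natDegree = k + 2 := by
    rw [hW, natDegree_prod_of_monic _ _ fun i _ => monic_X_sub_C _]; simp
  have hr : (W - lobattoPoly k).natDegree < k + 2 :=
    IsMonicOfDegree.natDegree_sub_lt (by omega) ⟨hWd, hWm⟩ ⟨hd, hm⟩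
  have hode := lobattoPoly_ode k
  have hT : (1 - X ^ 2) * derivative (derivative (W - lobattoPoly k)) +
      C (((k : ℝ) + 2) * (k + 1)) * (W - lobattoPoly k) = 0 := by
    have hlt := natDegree_ode_lt hr (((k : ℝ) + 2) * (k + 1))
    rw [← Fintype.card_fin (k + 2)] at hlt
    refine eq_zero_of_natDegree_lt_card_of_eval_eq_zero _ hx (fun i => ?_) hlt
    have e : (1 - X ^ 2) * derivative (derivative (W - lobattoPoly k)) +
      C (((k : ℝ) + 2) * (k + 1)) * (W - lobattoPoly k) =
      (1 - X ^ 2) * derivative (derivative W) + C (((k : ℝ) + 2) * (k + 1)) * W := by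
      rw [derivative_sub, derivative_sub]
      linear_combination -hode
    have hWx : W.eval (x i) = 0 := by
      rw [hW, eval_prod]
      exact Finset.prod_eq_zero (Finset.mem_univ i) (by simp)
    rw [e]
    simpa [hWx] using h i
  exact sub_eq_zero.mp (eq_zero_of_ode_of_natDegree_lt hr hT)

open Polynomial in
/-- The ordered discriminant of `k + 2` points of `[-1, 1]` is at most the one of the zeros of
`lobattoPoly k`. -/
theorem prod_abs_sub_le_maxDiscr {k : ℕ} {y : Fin (k + 2) → ℝ}
    (hy : ∀ i, y i ∈ Set.Icc (-1 : ℝ) 1) :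
    ∏ i, ∏ j ∈ Finset.univ.erase i, |y i - y j| ≤ maxDiscr k := by
  have hc : Continuous fun x : Fin (k + 2) → ℝ =>
      ∏ i, ∏ j ∈ Finset.univ.erase i, |x i - x j| := by fun_prop
  obtain ⟨x, hx, hmax⟩ := (isCompact_univ_pi fun _ : Fin (k + 2) =>
    isCompact_Icc (a := (-1 : ℝ)) (b := 1)).exists_isMaxOn ⟨y, fun i _ => hy i⟩ hc.continuousOn
  refine (hmax (fun i _ => hy i : y ∈ _)).trans_eq ?_
  -- Any configuration of distinct points in `[-1, 1]` shows that the maximum is positive, so the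
  -- maximizing points are distinct.
  have hpos : 0 < ∏ i, ∏ j ∈ Finset.univ.erase i, |x i - x j| := by
    refine lt_of_lt_of_le ?_ (hmax (a := fun i => 1 / ((i : ℝ) + 1)) fun i _ => ?_)
    · refine Finset.prod_pos fun i _ => Finset.prod_pos fun j hj => abs_pos.mpr ?_
      rw [sub_ne_zero]
      intro h
      apply Finset.ne_of_mem_erase hj
      have hi : ((i : ℕ) : ℝ) + 1 ≠ 0 := by positivity
      have hj' : ((j : ℕ) : ℝ) + 1 ≠ 0 := by positivity
      field_simp at h
      exact Fin.ext (by exact_mod_cast (add_right_cancel h : ((j : ℕ) : ℝ) = (i : ℕ)))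
    · have hi : (0 : ℝ) ≤ ((i : ℕ) : ℝ) := Nat.cast_nonneg _
      refine ⟨le_trans (by norm_num) (by positivity : (0 : ℝ) ≤ _), ?_⟩
      rw [div_le_one (by positivity)]
      linarith
  have hne : ∀ i, ∀ j ∈ Finset.univ.erase i, x i - x j ≠ 0 := by
    intro i j hj
    have h1 := Finset.prod_ne_zero_iff.mp hpos.ne' i (Finset.mem_univ i)
    exact abs_ne_zero.mp (Finset.prod_ne_zero_iff.mp h1 j hj)
  have hinj : Function.Injective x := by
    intro i j hij
    by_contra h
    exact hne i j (Finset.mem_erase.mpr ⟨Ne.symm h, Finset.mem_univ j⟩) (sub_eq_zero.mpr hij)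
  set G : Fin (k + 2) → ℝ[X] := fun i => ∏ j ∈ Finset.univ.erase i, (X - C (x j)) with hG
  have hGe : ∀ i t, (G i).eval t = ∏ j ∈ Finset.univ.erase i, (t - x j) := by
    intro i t; simp [hG, eval_prod]
  have hWG : ∀ i, ∏ i, (X - C (x i)) = (X - C (x i)) * G i := fun i =>
    (Finset.mul_prod_erase Finset.univ (fun j => X - C (x j)) (Finset.mem_univ i)).symm
  -- At an interior maximizer, `G i ^ 2` is stationary and `G i` is nonzero, so `G i` is stationary.
  -- As `W'' = 2 (G i)'` at `x i`, this is the hypothesis of `eq_lobattoPoly_of_eval_eq_zero`; at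
  -- the endpoints `1 - x²` vanishes instead.
  have hcrit : ∀ i, x i ∈ Set.Ioo (-1 : ℝ) 1 → (derivative (G i)).eval (x i) = 0 := by
    intro i hi
    have hle : ∀ t ∈ Set.Icc (-1 : ℝ) 1, (G i ^ 2).eval t ≤ (G i ^ 2).eval (x i) := by
      intro t ht
      have hu := hmax (a := Function.update x i t) (fun j _ => by
        by_cases hj : j = i
        · subst hj; simpa using ht
        · simpa [hj] using hx j (Set.mem_univ j))
      have hrest : ∏ a ∈ Finset.univ.erase i, ∏ b ∈ (Finset.univ.erase a).erase i,
          |Function.update x i t a - Function.update x i t b| =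
          ∏ a ∈ Finset.univ.erase i, ∏ b ∈ (Finset.univ.erase a).erase i, |x a - x b| := by
        refine Finset.prod_congr rfl fun a ha => Finset.prod_congr rfl fun b hb => ?_
        rw [Function.update_of_ne (Finset.ne_of_mem_erase ha),
          Function.update_of_ne (Finset.ne_of_mem_erase hb)]
      have hfst : ∏ b ∈ Finset.univ.erase i,
          (Function.update x i t i - Function.update x i t b) =
          ∏ b ∈ Finset.univ.erase i, (t - x b) := by
        refine Finset.prod_congr rfl fun b hb => ?_
        rw [Function.update_self, Function.update_of_ne (Finset.ne_of_mem_erase hb)]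
      simp only [Set.mem_ofPred_eq] at hu
      rw [prod_prod_erase_abs_sub _ i, prod_prod_erase_abs_sub x i, hrest, hfst] at hu
      rw [eval_pow, eval_pow, hGe, hGe]
      refine le_of_mul_le_mul_right hu (Finset.prod_pos fun a ha => Finset.prod_pos fun b hb =>
        abs_pos.mpr (hne a b (Finset.mem_of_mem_erase hb)))
    have hloc : IsLocalMax (fun t => (G i ^ 2).eval t) (x i) := by
      filter_upwards [Ioo_mem_nhds hi.1 hi.2] with t ht
      exact hle t (Set.Ioo_subset_Icc_self ht)
    have hd := hloc.hasDerivAt_eq_zero ((G i ^ 2).hasDerivAt (x i))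
    have hGne : (G i).eval (x i) ≠ 0 := by
      rw [hGe]; exact Finset.prod_ne_zero_iff.mpr (hne i)
    simpa [derivative_pow, hGne] using hd
  have hW := eq_lobattoPoly_of_eval_eq_zero hinj (fun i => by
    by_cases hi : x i ∈ Set.Ioo (-1 : ℝ) 1
    · rw [hWG i]
      simp [hcrit i hi]
    · have h1 := hx i (Set.mem_univ i)
      have h2 : x i = -1 ∨ x i = 1 := by
        by_contra! h
        exact hi ⟨lt_of_le_of_ne h1.1 h.1.symm, lt_of_le_of_ne h1.2 h.2⟩
      rcases h2 with h2 | h2 <;> simp [h2])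
  rw [← prod_abs_derivative_lobattoPoly hW]
  refine Finset.prod_congr rfl fun i _ => ?_
  rw [← hW, hWG i, ← Finset.abs_prod, ← hGe]
  simp

/-! ### Numerical bounds for the maximal discriminant. -/

/-- With `m = j + 1`, four times the base exceeds `1` by `1 / (4m² - 1) ≤ 1 / (3m²)`. Raising to the
power `m` turns the error into `1 / (3m)`, whence the harmonic sum. -/
theorem log_prod_legendre_coeff_le (k : ℕ) :
    Real.log (∏ j ∈ Finset.range k,
      (((j : ℝ) + 1) ^ 2 / (4 * ((j : ℝ) + 1) ^ 2 - 1)) ^ (j + 1)) ≤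
      -(k * (k + 1) * Real.log 2) + (1 / 3) * (harmonic k : ℝ) := by
  have hd : ∀ j : ℕ, 0 < 4 * ((j : ℝ) + 1) ^ 2 - 1 := fun j => by
    have : (0 : ℝ) ≤ j := j.cast_nonneg
    nlinarith
  induction k with
  | zero => simp
  | succ k ih =>
    have hk : (0 : ℝ) ≤ k := k.cast_nonneg
    have hb : 0 < ((k : ℝ) + 1) ^ 2 / (4 * ((k : ℝ) + 1) ^ 2 - 1) :=
      div_pos (by positivity) (hd k)
    rw [Finset.prod_range_succ, Real.log_mul _ (pow_pos hb _).ne', Real.log_pow, harmonic_succ]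
    · have h1 : Real.log (((k : ℝ) + 1) ^ 2 / (4 * ((k : ℝ) + 1) ^ 2 - 1)) ≤
          -(2 * Real.log 2) + 1 / (3 * ((k : ℝ) + 1) ^ 2) := by
        have h2 := Real.log_le_sub_one_of_pos (mul_pos (by norm_num : (0 : ℝ) < 2 ^ 2) hb)
        rw [Real.log_mul (by norm_num) hb.ne', Real.log_pow] at h2
        have h3 : 2 ^ 2 * (((k : ℝ) + 1) ^ 2 / (4 * ((k : ℝ) + 1) ^ 2 - 1)) - 1 ≤
            1 / (3 * ((k : ℝ) + 1) ^ 2) := by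
          have := hd k
          rw [← sub_nonneg]
          have e : 1 / (3 * ((k : ℝ) + 1) ^ 2) -
            (2 ^ 2 * (((k : ℝ) + 1) ^ 2 / (4 * ((k : ℝ) + 1) ^ 2 - 1)) - 1) =
            (((k : ℝ) + 1) ^ 2 - 1) / (3 * ((k : ℝ) + 1) ^ 2 * (4 * ((k : ℝ) + 1) ^ 2 - 1)) := by
            rw [show 4 * ((k : ℝ) + 1) ^ 2 - 1 = (2 * k + 1) * (2 * k + 3) by ring]
            field_simp
            ring
          rw [e]
          apply div_nonneg _ (by positivity)
          nlinarith
        push_cast at h2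
        linarith
      have h4 := mul_le_mul_of_nonneg_left h1 (by positivity : (0 : ℝ) ≤ (k : ℝ) + 1)
      have h5 : ((k : ℝ) + 1) * (1 / (3 * ((k : ℝ) + 1) ^ 2)) = 1 / 3 * ((k : ℝ) + 1)⁻¹ := by
        field_simp
      push_cast
      linear_combination ih + h4 + h5
    · exact (Finset.prod_pos fun j _ => pow_pos (div_pos (by positivity) (hd j)) _).ne'

theorem maxDiscr_pos (k : ℕ) : 0 < maxDiscr k := by
  have hk : (0 : ℝ) ≤ k := k.cast_nonneg
  refine mul_pos (by positivity) (mul_pos (by positivity) (Finset.prod_pos fun j _ =>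
    pow_pos (div_pos (by positivity) ?_) _))
  have : (0 : ℝ) ≤ j := j.cast_nonneg
  nlinarith

theorem log_maxDiscr_le (k : ℕ) :
    Real.log (maxDiscr k) ≤
      ((k : ℝ) + 2 + 1 / 3) * Real.log (k + 2) - ((k : ℝ) + 1) ^ 2 * Real.log 2 + 4 / 3 := by
  have hk : (0 : ℝ) ≤ k := k.cast_nonneg
  have h0 := maxDiscr_pos k
  have hP := log_prod_legendre_coeff_le k
  rw [maxDiscr] at h0 ⊢
  have h1 := (pos_iff_pos_of_mul_pos h0).mp (by positivity)
  have h2 := (pos_iff_pos_of_mul_pos h1).mp (by positivity)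
  rw [Real.log_mul (by positivity) h1.ne', Real.log_mul (by positivity) h2.ne', Real.log_pow,
    Real.log_pow]
  have h3 : Real.log (((k : ℝ) + 1) / (2 * k + 1)) ≤ -Real.log 2 + 1 / (2 * k + 1) := by
    have h4 := Real.log_le_sub_one_of_pos
      (by positivity : (0 : ℝ) < 2 * (((k : ℝ) + 1) / (2 * k + 1)))
    rw [Real.log_mul (by norm_num) (by positivity)] at h4
    have : 2 * (((k : ℝ) + 1) / (2 * k + 1)) - 1 = 1 / (2 * k + 1) := by field_simp; ring
    linarith
  have h5 := mul_le_mul_of_nonneg_left h3 (by positivity : (0 : ℝ) ≤ (k : ℝ) + 1)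
  have h6 : ((k : ℝ) + 1) * (1 / (2 * k + 1)) ≤ 1 := by
    rw [mul_one_div, div_le_one (by positivity)]; linarith
  have h7 : (harmonic k : ℝ) ≤ 1 + Real.log (k + 2) := by
    have h8 := harmonic_le_one_add_log k
    rcases Nat.eq_zero_or_pos k with h9 | h9
    · subst h9
      simp only [harmonic_zero, Rat.cast_zero]
      have : 0 ≤ Real.log (((0 : ℕ) : ℝ) + 2) := Real.log_nonneg (by norm_num)
      linarith
    · have : Real.log k ≤ Real.log (k + 2) :=
        Real.log_le_log (by exact_mod_cast h9) (by linarith)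
      linarith
  push_cast
  linear_combination h5 + h6 + hP + (1 / 3) * h7

-- With `n = k + 2`, the gain `(2 log 2 - 1.38) n(n-1)` must exceed `(n-1) log 2 + (n + 1/3) log n +
-- 4/3`. This barely holds at `n = 1244`.
set_option exponentiation.threshold 400 in
theorem log_maxDiscr_lt {k : ℕ} (hk : 1242 ≤ k) :
    Real.log (maxDiscr k) < ((k : ℝ) + 2) * (k + 1) * (Real.log 2 - 1.38) := by
  refine (log_maxDiscr_le k).trans_lt ?_
  obtain ⟨t, rfl⟩ := Nat.exists_eq_add_of_le hk
  have ht : (0 : ℝ) ≤ t := t.cast_nonneg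
  push_cast
  have hl1 := Real.log_two_gt_d9
  have hl2 := Real.log_two_lt_d9
  -- The margin at `1244` is small, so a sharp rational multiple of `log 2` is needed; larger
  -- arguments are handled by the tangent line of the logarithm at `1244`.
  have hL : Real.log 1244 ≤ 329 / 32 * Real.log 2 := by
    have h := Real.log_le_log (by norm_num) (by norm_num : (1244 : ℝ) ^ 32 ≤ 2 ^ 329)
    rw [Real.log_pow, Real.log_pow] at h
    push_cast at h
    linarith
  have hn : Real.log (1242 + (t : ℝ) + 2) ≤ 7.12643 + t / 1244 := by
    have h1 := Real.log_le_sub_one_of_pos (by positivity : (0 : ℝ) < (1242 + t + 2) / 1244)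
    rw [Real.log_div (by positivity) (by norm_num)] at h1
    linarith
  have h2 := mul_le_mul_of_nonneg_left hn (by positivity : (0 : ℝ) ≤ 1242 + (t : ℝ) + 2 + 1 / 3)
  have h3 := mul_le_mul_of_nonneg_left hl1.le
    (by positivity : (0 : ℝ) ≤ (1242 + (t : ℝ) + 1) ^ 2 + (1242 + (t : ℝ) + 2) * (1242 + t + 1))
  nlinarith

/-! ### The arithmetic lower bound. -/

theorem sum_vonMangoldt_filter_dvd_le_log (Q : Finset ℕ) {n : ℕ} (hn : n ≠ 0) :
    ∑ q ∈ Q with q ∣ n, ArithmeticFunction.vonMangoldt q ≤ Real.log n := by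
  rw [← ArithmeticFunction.vonMangoldt_sum]
  refine Finset.sum_le_sum_of_subset_of_nonneg (fun q hq => ?_)
    fun _ _ _ => ArithmeticFunction.vonMangoldt_nonneg
  exact Nat.mem_divisors.mpr ⟨(Finset.mem_filter.mp hq).2, hn⟩

/-- Cauchy–Schwarz on the fibre sizes of `f`: their squares count all pairs with equal image, and
the diagonal contributes `S.card`. -/
theorem sq_card_div_le_card_pairs {α β : Type*} [DecidableEq α] [DecidableEq β] (S : Finset α)
    (f : α → β) {c : ℕ} (hc : 0 < c) (h : (S.image f).card ≤ c) :
    (S.card : ℝ) ^ 2 / c - S.card ≤ (S.offDiag.filter fun p => f p.1 = f p.2).card := by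
  have h1 : (S.card : ℝ) = ∑ b ∈ S.image f, ((S.filter fun a => f a = b).card : ℝ) := by
    exact_mod_cast Finset.card_eq_sum_card_image f S
  have h2 := sq_sum_le_card_mul_sum_sq (s := S.image f)
    (f := fun b => ((S.filter fun a => f a = b).card : ℝ))
  rw [← h1] at h2
  have h3 : ∑ b ∈ S.image f, ((S.filter fun a => f a = b).card : ℝ) ^ 2 =
      S.card + ((S.offDiag.filter fun p => f p.1 = f p.2).card : ℝ) := by
    have h4 : ((S ×ˢ S).filter fun p => f p.1 = f p.2).card =
        S.card + (S.offDiag.filter fun p => f p.1 = f p.2).card := by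
      rw [← Finset.diag_union_offDiag, Finset.filter_union,
        Finset.card_union_of_disjoint (Finset.disjoint_filter_filter S.disjoint_diag_offDiag),
        Finset.filter_true_of_mem, Finset.diag_card]
      intro p hp
      rw [(Finset.mem_diag.mp hp).2]
    have h5 : ((S ×ˢ S).filter fun p => f p.1 = f p.2).card =
        ∑ b ∈ S.image f, (S.filter fun a => f a = b).card ^ 2 := by
      rw [Finset.card_eq_sum_card_fiberwise (f := fun p => f p.1) (t := S.image f)]
      · refine Finset.sum_congr rfl fun b _ => ?_
        rw [sq, ← Finset.card_product]
        congr 1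
        ext ⟨a, a'⟩
        simp only [Finset.mem_filter, Finset.mem_product]
        constructor
        · rintro ⟨⟨⟨h1, h2⟩, h3⟩, h4⟩
          exact ⟨⟨h1, h4⟩, h2, h3.symm.trans h4⟩
        · rintro ⟨⟨h1, h4⟩, h2, h3⟩
          exact ⟨⟨⟨h1, h2⟩, h4.trans h3.symm⟩, h4⟩
      · intro p hp
        exact Finset.mem_image_of_mem f (Finset.mem_product.mp (Finset.mem_filter.mp hp).1).1
    have := h5.symm.trans h4
    exact_mod_cast this
  rw [h3] at h2
  have hc' : (0 : ℝ) < c := by exact_mod_cast hc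
  rw [sub_le_iff_le_add, div_le_iff₀ hc']
  have h6 : ((S.image f).card : ℝ) ≤ c := by exact_mod_cast h
  have h7 := mul_le_mul_of_nonneg_right h6
    (by positivity : (0 : ℝ) ≤ S.card + ((S.offDiag.filter fun p => f p.1 = f p.2).card : ℝ))
  linarith

/-- The lower bound for the discriminant of a set of integers lying in few residue classes. -/
theorem sum_vonMangoldt_mul_le_sum_log (S : Finset ℤ) (Q : Finset ℕ) (ν : ℕ → ℕ)
    (hν : ∀ q ∈ Q, 1 ≤ ν q)
    (h : ∀ q ∈ Q, (S.image (fun n : ℤ => (n : ZMod q))).card ≤ ν q) :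
    ∑ q ∈ Q, ArithmeticFunction.vonMangoldt q * ((S.card : ℝ) ^ 2 / ν q - S.card) ≤
      ∑ p ∈ S.offDiag, Real.log |((p.1 : ℝ) - p.2)| := by
  calc _ ≤ ∑ q ∈ Q, ∑ p ∈ S.offDiag,
        if q ∣ (p.1 - p.2).natAbs then ArithmeticFunction.vonMangoldt q else 0 := by
        refine Finset.sum_le_sum fun q hq => ?_
        rw [← Finset.sum_filter, Finset.sum_const, nsmul_eq_mul, mul_comm (Finset.card _ : ℝ)]
        refine mul_le_mul_of_nonneg_left ?_ ArithmeticFunction.vonMangoldt_nonneg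
        refine (sq_card_div_le_card_pairs S _ (hν q hq) (h q hq)).trans_eq ?_
        congr 2
        refine Finset.filter_congr fun p _ => ?_
        rw [← Int.natCast_dvd, ← ZMod.intCast_zmod_eq_zero_iff_dvd, Int.cast_sub, sub_eq_zero]
    _ = ∑ p ∈ S.offDiag, ∑ q ∈ Q,
        if q ∣ (p.1 - p.2).natAbs then ArithmeticFunction.vonMangoldt q else 0 := Finset.sum_comm
    _ ≤ _ := by
        refine Finset.sum_le_sum fun p hp => ?_
        rw [← Finset.sum_filter]
        have hne := (Finset.mem_offDiag.mp hp).2.2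
        refine (sum_vonMangoldt_filter_dvd_le_log Q
          (Int.natAbs_ne_zero.mpr (sub_ne_zero.mpr hne))).trans_eq ?_
        rw [Nat.cast_natAbs]
        push_cast
        rfl

/-! ### Rescaling to integers, and the conclusion. -/

/-- The upper bound for the discriminant of more than `1243` reals in an interval of
length `M`. -/
theorem sum_log_abs_sub_lt (N M : ℝ) (hM : 0 < M) (S : Finset ℤ)
    (hS : ∀ n ∈ S, (n : ℝ) ∈ Set.Icc N (N + M)) (hc : 1243 < S.card) :
    ∑ p ∈ S.offDiag, Real.log |((p.1 : ℝ) - p.2)| <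
      (S.card : ℝ) * (S.card - 1) * (Real.log M - 1.38) := by
  obtain ⟨k, hk⟩ : ∃ k, S.card = k + 2 := ⟨S.card - 2, by omega⟩
  let e := (S.equivFinOfCardEq hk).symm
  let y : Fin (k + 2) → ℝ := fun i => 2 * (((e i : ℤ) : ℝ) - N) / M - 1
  have hy : ∀ i, y i ∈ Set.Icc (-1 : ℝ) 1 := by
    intro i
    obtain ⟨h1, h2⟩ := hS _ (e i).2
    constructor
    · have : 0 ≤ 2 * (((e i : ℤ) : ℝ) - N) / M := div_nonneg (by linarith) hM.le
      simp only [y]; linarith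
    · have : 2 * (((e i : ℤ) : ℝ) - N) / M ≤ 2 := by
        rw [div_le_iff₀ hM]; linarith
      simp only [y]; linarith
  have hsub : ∀ i j, y i - y j = 2 / M * (((e i : ℤ) : ℝ) - (e j : ℤ)) := by
    intro i j; simp only [y]; ring
  have hne : ∀ i, ∀ j ∈ Finset.univ.erase i, ((e i : ℤ) : ℝ) - (e j : ℤ) ≠ 0 := by
    intro i j hj h
    rw [sub_eq_zero] at h
    exact Finset.ne_of_mem_erase hj (e.injective (Subtype.ext (by exact_mod_cast h.symm)))
  have hyne : ∀ i, ∀ j ∈ Finset.univ.erase i, |y i - y j| ≠ 0 := by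
    intro i j hj
    rw [hsub]
    exact abs_ne_zero.mpr (mul_ne_zero (by positivity) (hne i j hj))
  have hmax := prod_abs_sub_le_maxDiscr hy
  -- Each of the `(k + 2)(k + 1)` ordered pairs is scaled by `2 / M`; the resulting `log 2` cancels
  -- the one in `log_maxDiscr_lt`.
  have hlog : Real.log (∏ i, ∏ j ∈ Finset.univ.erase i, |y i - y j|) =
      ((k : ℝ) + 2) * (k + 1) * (Real.log 2 - Real.log M) +
        ∑ i, ∑ j ∈ Finset.univ.erase i, Real.log |((e i : ℤ) : ℝ) - (e j : ℤ)| := by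
    rw [Real.log_prod fun i _ => Finset.prod_ne_zero_iff.mpr (hyne i)]
    have : ∀ i, Real.log (∏ j ∈ Finset.univ.erase i, |y i - y j|) =
        ((k : ℝ) + 1) * (Real.log 2 - Real.log M) +
        ∑ j ∈ Finset.univ.erase i, Real.log |((e i : ℤ) : ℝ) - (e j : ℤ)| := by
      intro i
      rw [Real.log_prod (hyne i)]
      have h1 : ∀ j ∈ Finset.univ.erase i, Real.log |y i - y j| =
          (Real.log 2 - Real.log M) + Real.log |((e i : ℤ) : ℝ) - (e j : ℤ)| := by
        intro j hj
        rw [hsub, abs_mul, Real.log_mul (by positivity) (abs_ne_zero.mpr (hne i j hj)),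
          abs_of_pos (by positivity), Real.log_div (by norm_num) hM.ne']
      rw [Finset.sum_congr rfl h1, Finset.sum_add_distrib]
      simp
      ring
    simp only [this, Finset.sum_add_distrib]
    simp
    ring
  have hsum : ∑ i, ∑ j ∈ Finset.univ.erase i, Real.log |((e i : ℤ) : ℝ) - (e j : ℤ)| =
      ∑ p ∈ S.offDiag, Real.log |((p.1 : ℝ) - p.2)| := by
    -- Diagonal terms may be added freely because `Real.log 0 = 0`.
    have h1 : ∑ p ∈ S.offDiag, Real.log |((p.1 : ℝ) - p.2)| =
        ∑ p ∈ S ×ˢ S, Real.log |((p.1 : ℝ) - p.2)| := by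
      refine Finset.sum_subset (fun p hp => Finset.mem_product.mpr
        ⟨(Finset.mem_offDiag.mp hp).1, (Finset.mem_offDiag.mp hp).2.1⟩) fun p hp hp' => ?_
      have : p.1 = p.2 := by
        by_contra h
        obtain ⟨h1, h2⟩ := Finset.mem_product.mp hp
        exact hp' (Finset.mem_offDiag.mpr ⟨h1, h2, h⟩)
      simp [this]
    rw [h1, Finset.sum_product, ← Finset.sum_coe_sort S, ← e.sum_comp]
    refine Finset.sum_congr rfl fun i _ => ?_
    rw [← Finset.sum_coe_sort S, ← e.sum_comp]
    exact Finset.sum_erase _ (by simp)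
  have hpos : 0 < ∏ i, ∏ j ∈ Finset.univ.erase i, |y i - y j| :=
    Finset.prod_pos fun i _ => Finset.prod_pos fun j hj =>
      (abs_nonneg _).lt_of_ne (hyne i j hj).symm
  have h1 := (Real.log_le_log hpos hmax).trans_lt (log_maxDiscr_lt (k := k) (by omega))
  rw [hlog, hsum] at h1
  rw [hk]
  push_cast
  linarith

theorem corollary1
    (N M : ℝ) (hM : 0 < M)
    (S : Finset ℤ) (hS : ∀ n ∈ S, (n : ℝ) ∈ Set.Icc N (N + M))
    (Q : Finset ℕ) (hQ : (Q : Set ℕ).Pairwise Nat.Coprime)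
    (ν : ℕ → ℕ) (hν : ∀ q ∈ Q, 1 ≤ ν q ∧ ν q ≤ q)
    (hclasses : ∀ q ∈ Q, (S.image (fun n : ℤ => (n : ZMod q))).card ≤ ν q) :
    S.card ≤ 1243 ∨
      (0 < (∑ q ∈ Q, ArithmeticFunction.vonMangoldt q / (ν q : ℝ)) - Real.log M + 1.38 →
        (S.card : ℝ) <
          ((∑ q ∈ Q, ArithmeticFunction.vonMangoldt q) - Real.log M + 1.38) /
            ((∑ q ∈ Q, ArithmeticFunction.vonMangoldt q / (ν q : ℝ)) - Real.log M + 1.38)) := by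
  refine or_iff_not_imp_left.mpr fun hc hpos => ?_
  rw [not_le] at hc
  have h1 := (sum_vonMangoldt_mul_le_sum_log S Q ν (fun q hq => (hν q hq).1) hclasses).trans_lt
    (sum_log_abs_sub_lt N M hM S hS hc)
  have h2 : ∑ q ∈ Q, ArithmeticFunction.vonMangoldt q * ((S.card : ℝ) ^ 2 / ν q - S.card) =
      S.card * (S.card * (∑ q ∈ Q, ArithmeticFunction.vonMangoldt q / (ν q : ℝ)) -
        ∑ q ∈ Q, ArithmeticFunction.vonMangoldt q) := by
    rw [Finset.mul_sum, ← Finset.sum_sub_distrib, Finset.mul_sum]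
    exact Finset.sum_congr rfl fun q _ => by ring
  have hS0 : (0 : ℝ) < S.card := by exact_mod_cast (by omega : 0 < S.card)
  rw [h2, mul_assoc] at h1
  -- Cancelling one factor `S` leaves `S * A - B < (S - 1) * (log M - 1.38)`, where `A` and `B` are
  -- the sums of `Λ(q)/ν(q)` and `Λ(q)`; this is linear in `S`.
  have h3 := lt_of_mul_lt_mul_left h1 hS0.le
  rw [lt_div_iff₀ hpos]
  linarith
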